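/- For $\tau$ in the upper half-plane $\mathfrak{H}$ put $q=e^{2\pi i\tau}$, let $E_4(\tau)=1+240\sum_{n\ge1}\sigma_3(n)q^n$ be the normalized Eisenstein series of weight $4$, and let $$g_8(\tau)=\frac{E_4(\tau)-21E_4(2\tau)+84E_4(4\tau)-64E_4(8\tau)}{240}.$$ Then $g_8$ has a $q$-expansion without constant term, $g_8(\tau)=\sum_{n\ge1}a_nq^n$, converging for every $\tau\in\mathfrak{H}$, and its weight $-2$ Eichler integral $$E(\tau)=\sum_{n\ge1}\frac{a_n}{n^3}q^n$$ converges for every $\tau\in\mathfrak{H}$. Let $W_8=\begin{pmatrix}0&-1\\8&0\end{pmatrix}$, acting on $\mathfrak{H}$ by $W_8\tau=-\frac1{8\tau}$, and for $\gamma=\begin{pmatrix}a&b\\c&d\end{pmatrix}$ with $\det\gamma>0$ let $(F|_k\gamma)(\tau)=(\det\gamma)^{k/2}(c\tau+d)^{-k}F(\gamma\tau)$, so that $(F|_{-2}W_8)(\tau)=8\tau^2F(W_8\tau)$. Then $$P_8(\tau):=(E|_{-2}W_8)(\tau)+E(\tau)$$ is a polynomial in $\tau$ of degree at most $2$; explicitly,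 for every $\tau\in\mathfrak{H}$, $$P_8(\tau)=(E|_{-2}W_8)(\tau)+E(\tau)=\frac{7}{32}\,\zeta(3)\,(8\tau^2+1).$$ -/

import Mathlib

open scoped UpperHalfPlane MatrixGroups

noncomputable section

/-- The point `m τ` of the upper half-plane, for a positive integer `m`. -/
def scaleTau (m : ℕ+) (τ : ℍ) : ℍ :=
  ⟨((m : ℕ) : ℂ) * (τ : ℂ), by
    have h : (0 : ℝ) < ((m : ℕ) : ℝ) := Nat.cast_pos.mpr m.pos
    simpa using mul_pos h τ.im_pos⟩

/-- `g₈(τ) = (E₄(τ) - 21 E₄(2τ) + 84 E₄(4τ) - 64 E₄(8τ)) / 240`, where `E₄` is the Eisenstein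
series of weight `4` and level `1` normalized to have constant term `1`. -/
def g8 (τ : ℍ) : ℂ :=
  (ModularForm.E₄ τ - 21 * ModularForm.E₄ (scaleTau 2 τ) + 84 * ModularForm.E₄ (scaleTau 4 τ)
    - 64 * ModularForm.E₄ (scaleTau 8 τ)) / 240

/-- The nome `q = exp (2 π i τ)`. -/
def nome (τ : ℍ) : ℂ := Complex.exp (2 * Real.pi * Complex.I * τ)

/-- The `n`-th coefficient of the expansion of `f` in powers of `q = exp (2 π i τ)`. -/
def fourierCoefficient (f : ℍ → ℂ) (n : ℕ) : ℂ :=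
  (UpperHalfPlane.qExpansion 1 f).coeff n

/-- The normalized weight `-2` Eichler integral `∑_{n ≥ 1} a_n n⁻³ qⁿ`
of `f = ∑_{n ≥ 1} a_n qⁿ`. -/
def eichlerIntegral (f : ℍ → ℂ) (τ : ℍ) : ℂ :=
  ∑' n : ℕ+, fourierCoefficient f n / ((n : ℕ) : ℂ) ^ 3 * nome τ ^ (n : ℕ)

/-- The weight `k` slash operator of a real matrix `γ` of positive determinant, normalized so that
scalar matrices act trivially for even `k`:
`(f|_k γ)(τ) = (det γ)^(k/2) (c τ + d)^(-k) f(γ τ)`.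
(The slash action of Mathlib has `(det γ)^(k-1)` in place of `(det γ)^(k/2)`.) -/
def slashOp (k : ℤ) (γ : GL(2, ℝ)⁺) (f : ℍ → ℂ) (τ : ℍ) : ℂ :=
  ((((γ : GL (Fin 2) ℝ).det : ℝ) ^ ((k : ℝ) / 2) : ℝ) : ℂ)
    * UpperHalfPlane.denom (γ : GL (Fin 2) ℝ) τ ^ (-k) * f (γ • τ)

/-- The Fricke matrix of level `8`, with rows `(0, -1)` and `(8, 0)`; it acts on the upper
half-plane by `τ ↦ -1 / (8 τ)`. -/
def frickeW8 : GL(2, ℝ)⁺ :=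
  ⟨Matrix.GeneralLinearGroup.mkOfDetNeZero !![0, -1; 8, 0] (by simp [Matrix.det_fin_two]),
    by simp [Matrix.GeneralLinearGroup.mkOfDetNeZero, Matrix.det_fin_two]⟩

/-- `P₈ = E|_{-2} W₈ + E`, where `E` is the Eichler integral of `g₈`. -/
def periodP8 (τ : ℍ) : ℂ :=
  slashOp (-2) frickeW8 (eichlerIntegral g8) τ + eichlerIntegral g8 τ

end

open UpperHalfPlane hiding I
open ArithmeticFunction Complex

/-! Let φ(τ) = ∑ σ₃(n) n⁻³ qⁿ (`eichlerSigma`). As a double series φ = ∑ m⁻³ q^{mn}; summing over n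
by the partial fractions of the cotangent gives ζ(3), ζ(4)/z and z ∑ 1/(m²(m²z² - n²))
(`eichlerSigma_eq`). Under z ↦ -1/z, with m and n exchanged, the last double sums add up to a
constant, so z²φ(-1/z) - φ(z) is elementary (`exists_eichlerSigma_inversion`). The Eichler integral
of `g8` combines φ(eτ) for e = 1, 2, 4, 8, and W₈ exchanges e with 8/e. With the weights 1, -21, 84,
-64 every φ and every term in τ⁻¹, τ, τ³ cancels; only ζ(3) survives. -/

noncomputable section

/-! ### The q-series of g₈ -/

/-- The coefficients of `f(q ^ e)` as a power series in `q`, where `b` are those of `f`. -/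
def dilate (e : ℕ+) (b : ℕ → ℂ) (n : ℕ) : ℂ := if (e : ℕ) ∣ n then b (n / e) else 0

lemma hasSum_dilate {b : ℕ → ℂ} {r s : ℂ} (e : ℕ+)
    (h : HasSum (fun n : ℕ => b n * (r ^ (e : ℕ)) ^ n) s) :
    HasSum (fun n : ℕ => dilate e b n * r ^ n) s := by
  have hinj : Function.Injective fun n : ℕ => (e : ℕ) * n :=
    fun _ _ hab => Nat.eq_of_mul_eq_mul_left e.pos hab
  refine (hinj.hasSum_iff ?_).mp (h.congr_fun ?_)
  · intro x hx
    have : ¬ (e : ℕ) ∣ x := fun ⟨k, hk⟩ => hx ⟨k, hk.symm⟩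
    simp [dilate, this]
  · intro n
    simp [dilate, pow_mul]

lemma dilate_div_cube (e : ℕ+) (b : ℕ → ℂ) (n : ℕ) :
    dilate e b n / (n : ℂ) ^ 3
      = dilate e (fun m => b m / (m : ℂ) ^ 3) n / ((e : ℕ) : ℂ) ^ 3 := by
  unfold dilate
  split_ifs with h
  · obtain ⟨k, rfl⟩ := h
    rw [Nat.mul_div_cancel_left _ e.pos]
    push_cast
    rw [mul_pow, div_div, mul_comm]
  · simp

lemma nome_scaleTau (e : ℕ+) (τ : ℍ) : nome (scaleTau e τ) = nome τ ^ (e : ℕ) := by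
  rw [nome, nome, ← Complex.exp_nat_mul]
  congr 1
  simp only [scaleTau]
  ring

lemma norm_nome_lt_one (τ : ℍ) : ‖nome τ‖ < 1 := norm_exp_two_pi_I_lt_one τ

lemma hasSum_sigma_three (τ : ℍ) :
    HasSum (fun n : ℕ => (sigma 3 n : ℂ) * nome τ ^ n) ((ModularForm.E₄ τ - 1) / 240) := by
  have hS : Summable fun n : ℕ => (sigma 3 n : ℂ) * nome τ ^ n :=
    EisensteinSeries.summable_sigma_mul_cexp_pow (k := 4) (by norm_num) τ
  have h := EisensteinSeries.q_expansion_bernoulli (k := 4) (by norm_num) ⟨2, rfl⟩ τ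
  have hb : bernoulli 4 = -1 / 30 := by decide +kernel
  have h0 := tsum_zero_pnat_eq_tsum_nat hS
  simp only [zpow_natCast, hb, Nat.add_one_sub_one] at h
  convert! hS.hasSum using 1
  rw [h, ← h0]
  simp only [nome]
  simp
  ring

/-- The coefficients of `g₈`. -/
def g8Coeff (n : ℕ) : ℂ :=
  dilate 1 (fun m => (sigma 3 m : ℂ)) n - 21 * dilate 2 (fun m => (sigma 3 m : ℂ)) n
    + 84 * dilate 4 (fun m => (sigma 3 m : ℂ)) n - 64 * dilate 8 (fun m => (sigma 3 m : ℂ)) n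

lemma g8Coeff_zero : g8Coeff 0 = 0 := by
  simp [g8Coeff, dilate]

lemma scaleTau_one (τ : ℍ) : scaleTau 1 τ = τ := by
  ext
  simp [scaleTau]

lemma hasSum_g8 (τ : ℍ) : HasSum (fun n : ℕ => g8Coeff n * nome τ ^ n) (g8 τ) := by
  have h (e : ℕ+) := hasSum_dilate e ((nome_scaleTau e τ) ▸ hasSum_sigma_three (scaleTau e τ))
  convert! (((h 1).sub ((h 2).mul_left 21)).add ((h 4).mul_left 84)).sub ((h 8).mul_left 64) using 1
  · funext n
    simp only [g8Coeff]
    ring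
  · simp only [g8, scaleTau_one]
    ring

/-! ### Identification of the Fourier coefficients -/

lemma nome_eq_qParam (τ : ℍ) : nome τ = Function.Periodic.qParam (1 : ℝ) τ := by
  simp [nome, Function.Periodic.qParam]

lemma periodic_of_hasSum_nome {f : ℍ → ℂ} {c : ℕ → ℂ}
    (hf : ∀ τ : ℍ, HasSum (fun n : ℕ => c n * nome τ ^ n) (f τ)) :
    Function.Periodic (f ∘ ofComplex) ((1 : ℝ) : ℂ) := by
  intro z
  by_cases hz : 0 < z.im
  · have hz' : 0 < (z + ((1 : ℝ) : ℂ)).im := by simpa using hz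
    simp only [Function.comp_apply, ofComplex_apply_of_im_pos hz, ofComplex_apply_of_im_pos hz']
    refine (hf _).unique ?_
    convert! hf ⟨z, hz⟩ using 3
    simp only [nome]
    rw [Complex.ofReal_one, mul_add, mul_one, Complex.exp_add, Complex.exp_two_pi_mul_I, mul_one]
  · have hz' : ¬ 0 < (z + ((1 : ℝ) : ℂ)).im := by simpa using hz
    simp only [Function.comp_apply, ofComplex_apply_of_im_nonpos (not_lt.mp hz),
      ofComplex_apply_of_im_nonpos (not_lt.mp hz')]

open scoped Manifold in
lemma mdifferentiable_comp_scaleTau {f : ℍ → ℂ} (hf : MDiff f) (m : ℕ+) :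
    MDiff fun τ => f (scaleTau m τ) := by
  rw [UpperHalfPlane.mdifferentiable_iff] at hf ⊢
  have him {z : ℂ} (hz : 0 < z.im) : 0 < (((m : ℕ) : ℂ) * z).im := by
    have h : (0 : ℝ) < ((m : ℕ) : ℝ) := Nat.cast_pos.mpr m.pos
    simpa using mul_pos h hz
  have h := hf.comp (f := fun z : ℂ => ((m : ℕ) : ℂ) * z) (s := {z | 0 < z.im})
    (by fun_prop) (fun z hz => him hz)
  refine h.congr fun z hz => ?_
  simp only [Function.comp_apply]
  rw [ofComplex_apply_of_im_pos hz, ofComplex_apply_of_im_pos (him hz)]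
  rfl

open scoped Manifold in
lemma mdifferentiable_g8 : MDiff g8 := by
  have hE : MDiff ModularForm.E₄ := ModularFormClass.holo ModularForm.E₄
  have h (m : ℕ+) := UpperHalfPlane.mdifferentiable_iff.mp (mdifferentiable_comp_scaleTau hE m)
  have h1 := UpperHalfPlane.mdifferentiable_iff.mp hE
  rw [UpperHalfPlane.mdifferentiable_iff]
  exact (((h1.sub ((h 2).const_mul 21)).add ((h 4).const_mul 84)).sub
    ((h 8).const_mul 64)).div_const 240

lemma fourierCoefficient_g8 (n : ℕ) : fourierCoefficient g8 n = g8Coeff n := by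
  have hs (τ : ℍ) : HasSum (fun m => g8Coeff m • Function.Periodic.qParam (1 : ℝ) τ ^ m) (g8 τ) := by
    simpa only [nome_eq_qParam, smul_eq_mul] using hasSum_g8 τ
  -- Lets the bare function `g8` stand where a term of a `FunLike` type is expected.
  let : FunLike (ℍ → ℂ) ℍ ℂ := ⟨id, Function.injective_id⟩
  exact (qExpansion_coeff_unique g8 one_pos (analyticAt_cuspFunction_zero one_pos
    (periodic_of_hasSum_nome hasSum_g8) mdifferentiable_g8
    (isBoundedAtImInfty_of_hasSum_qExpansion one_pos hs)) hs n).symm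

lemma hasSum_pnat_of_hasSum_nat {f : ℕ → ℂ} {s : ℂ} (h0 : f 0 = 0) (h : HasSum f s) :
    HasSum (fun n : ℕ+ => f n) s := by
  refine (PNat.coe_injective.hasSum_iff fun n hn => ?_).mpr h
  rcases Nat.eq_zero_or_pos n with rfl | hpos
  · exact h0
  · exact absurd ⟨⟨n, hpos⟩, rfl⟩ hn

/-! ### The Eichler integral as a combination of φ(eτ) -/

/-- The series `∑ σ₃(n) n⁻³ qⁿ`, the Eichler integral of `(E₄ - 1) / 240`. -/
def eichlerSigma (τ : ℍ) : ℂ := ∑' n : ℕ, (sigma 3 n : ℂ) / (n : ℂ) ^ 3 * nome τ ^ n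

lemma summable_eichlerSigma (τ : ℍ) :
    Summable fun n : ℕ => (sigma 3 n : ℂ) / (n : ℂ) ^ 3 * nome τ ^ n := by
  refine (hasSum_sigma_three τ).summable.norm.of_norm_bounded fun n => ?_
  rw [norm_mul, norm_mul, norm_div]
  gcongr
  rcases Nat.eq_zero_or_pos n with rfl | hpos
  · simp
  · refine div_le_self (norm_nonneg _) ?_
    rw [norm_pow, Complex.norm_natCast]
    exact one_le_pow₀ (by exact_mod_cast hpos)

lemma hasSum_eichlerIntegral_g8 (τ : ℍ) :
    HasSum (fun n : ℕ+ => fourierCoefficient g8 n / ((n : ℕ) : ℂ) ^ 3 * nome τ ^ (n : ℕ))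
      (eichlerSigma τ - 21 / 8 * eichlerSigma (scaleTau 2 τ)
        + 21 / 16 * eichlerSigma (scaleTau 4 τ) - 1 / 8 * eichlerSigma (scaleTau 8 τ)) := by
  simp only [fourierCoefficient_g8]
  apply hasSum_pnat_of_hasSum_nat (f := fun n => g8Coeff n / (n : ℂ) ^ 3 * nome τ ^ n)
  · simp
  have h (e : ℕ+) := hasSum_dilate e
    ((nome_scaleTau e τ) ▸ (summable_eichlerSigma (scaleTau e τ)).hasSum)
  -- Dividing by n³ turns each weight into weight/e³: 21/2³, 84/4³ = 21/16, 64/8³ = 1/8.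
  convert! (((h 1).sub ((h 2).mul_left (21 / 8))).add ((h 4).mul_left (21 / 16))).sub
    ((h 8).mul_left (1 / 8)) using 1
  · funext n
    simp only [g8Coeff, sub_div, add_div, mul_div_assoc, dilate_div_cube]
    norm_num
    ring
  · simp only [eichlerSigma, nome_scaleTau]
    simp

/-! ### Lambert series -/

lemma summable_pnat_one_div_pow {k : ℕ} (hk : 1 < k) :
    Summable fun m : ℕ+ => 1 / ((m : ℕ) : ℂ) ^ k := by
  have h : Summable fun m : ℕ => 1 / (m : ℂ) ^ k := by
    refine Summable.of_norm ?_
    simpa using Real.summable_one_div_nat_pow.mpr hk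
  exact h.comp_injective PNat.coe_injective

lemma tsum_pnat_one_div_pow {k : ℕ} (hk : 1 < k) :
    ∑' m : ℕ+, 1 / ((m : ℕ) : ℂ) ^ k = riemannZeta k := by
  have h : Summable fun m : ℕ => 1 / (m : ℂ) ^ k := by
    refine Summable.of_norm ?_
    simpa using Real.summable_one_div_nat_pow.mpr hk
  rw [zeta_nat_eq_tsum_of_gt_one hk, ← tsum_zero_pnat_eq_tsum_nat h]
  simp [show k ≠ 0 by omega]

lemma summable_lambert (τ : ℍ) :
    Summable fun p : ℕ+ × ℕ+ => 1 / ((p.1 : ℕ) : ℂ) ^ 3 * nome τ ^ (p.1 * p.2 : ℕ) := by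
  refine (summable_prod_mul_pow 0 (norm_nome_lt_one τ)).norm.of_norm_bounded fun p => ?_
  rw [pow_zero, one_mul, norm_mul]
  refine mul_le_of_le_one_left (norm_nonneg _) ?_
  rw [norm_div, norm_one, norm_pow, Complex.norm_natCast]
  exact div_le_one_of_le₀ (one_le_pow₀ (Nat.one_le_cast.mpr p.1.pos)) (by positivity)

lemma sum_divisorsAntidiagonal_one_div_cube (n : ℕ+) :
    ∑ x ∈ (n : ℕ).divisorsAntidiagonal, 1 / (x.1 : ℂ) ^ 3 = (sigma 3 n : ℂ) / ((n : ℕ) : ℂ) ^ 3 := by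
  rw [Nat.sum_divisorsAntidiagonal (fun a _ => 1 / (a : ℂ) ^ 3), sigma_eq_sum_div, Nat.cast_sum,
    Finset.sum_div]
  refine Finset.sum_congr rfl fun d hd => ?_
  obtain ⟨k, hk⟩ := Nat.dvd_of_mem_divisors hd
  have hn : ((n : ℕ) : ℂ) ≠ 0 := by exact_mod_cast n.ne_zero
  have hd0 : 0 < d := Nat.pos_of_mem_divisors hd
  rw [hk] at hn ⊢
  rw [Nat.mul_div_cancel_left _ hd0]
  push_cast at hn ⊢
  have := left_ne_zero_of_mul hn
  have := right_ne_zero_of_mul hn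
  field_simp

/-- Grouping the pairs by their product n leaves ∑_{d ∣ n} d⁻³ = σ₃(n)/n³. -/
lemma eichlerSigma_eq_tsum_prod (τ : ℍ) :
    eichlerSigma τ
      = ∑' p : ℕ+ × ℕ+, 1 / ((p.1 : ℕ) : ℂ) ^ 3 * nome τ ^ (p.1 * p.2 : ℕ) := by
  have h := sigmaAntidiagonalEquivProd.hasSum_iff.mpr (summable_lambert τ).hasSum
  have h' := h.sigma (g := fun n : ℕ+ => (sigma 3 n : ℂ) / ((n : ℕ) : ℂ) ^ 3 * nome τ ^ (n : ℕ))
    fun n => by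
      rw [← sum_divisorsAntidiagonal_one_div_cube, Finset.sum_mul, ← Finset.sum_coe_sort]
      convert! hasSum_fintype (fun x : (n : ℕ).divisorsAntidiagonal =>
        ((fun p : ℕ+ × ℕ+ => 1 / ((p.1 : ℕ) : ℂ) ^ 3 * nome τ ^ (p.1 * p.2 : ℕ)) ∘
          sigmaAntidiagonalEquivProd) ⟨n, x⟩) using 1
      refine Finset.sum_congr rfl fun x _ => ?_
      have hx := (Nat.mem_divisorsAntidiagonal.mp x.2).1
      simp [sigmaAntidiagonalEquivProd, divisorsAntidiagonalFactors, hx]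
  have hs := hasSum_pnat_of_hasSum_nat
    (f := fun n => (sigma 3 n : ℂ) / (n : ℂ) ^ 3 * nome τ ^ n) (by simp) (summable_eichlerSigma τ).hasSum
  rw [eichlerSigma]
  exact hs.unique h'

/-! ### The cotangent double series and inversion -/

/-- The terms of the double series obtained from the partial fractions of the cotangent. -/
def cotDoubleTerm (z : ℂ) (p : ℕ+ × ℕ+) : ℂ :=
  1 / (((p.1 : ℕ) : ℂ) ^ 2 * ((((p.1 : ℕ) : ℂ) * z) ^ 2 - ((p.2 : ℕ) : ℂ) ^ 2))

/-- Uniformity in m is the point: it makes `cotDoubleTerm` dominated by a multiple of 1/(m²n²). -/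
lemma mul_le_norm_sub_and_add (z : ℍ) (m n : ℕ+) :
    EisensteinSeries.r z * (n : ℕ) ≤ ‖((m : ℕ) : ℂ) * z - (n : ℕ)‖ ∧
      EisensteinSeries.r z * (n : ℕ) ≤ ‖((m : ℕ) : ℂ) * z + (n : ℕ)‖ := by
  have key (k : ℤ) (hk : ‖k‖ = (n : ℕ)) :
      EisensteinSeries.r z * (n : ℕ) ≤ ‖((m : ℕ) : ℂ) * z + k‖ := by
    have hx : (![(m : ℤ), k] : Fin 2 → ℤ) ≠ 0 := fun h => by
      have := congr_fun h 0
      simp at this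
    have h := EisensteinSeries.r_mul_max_le z hx
    have hle := norm_le_pi_norm (![(m : ℤ), k] : Fin 2 → ℤ) 1
    simp only [Matrix.cons_val_one, Matrix.cons_val_zero, Matrix.cons_val_fin_one, hk] at h hle
    refine (mul_le_mul_of_nonneg_left hle (EisensteinSeries.r_pos z).le).trans ?_
    simpa using h
  have h1 := key (-(n : ℕ)) (by rw [norm_neg]; simp)
  have h2 := key (n : ℕ) (by simp)
  constructor
  · simpa [sub_eq_add_neg] using h1
  · simpa using h2

lemma mul_sq_le_norm_sq_sub_sq (z : ℍ) (m n : ℕ+) :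
    EisensteinSeries.r z ^ 2 * ((n : ℕ) : ℝ) ^ 2
      ≤ ‖(((m : ℕ) : ℂ) * z) ^ 2 - ((n : ℕ) : ℂ) ^ 2‖ := by
  obtain ⟨h1, h2⟩ := mul_le_norm_sub_and_add z m n
  rw [sq_sub_sq, norm_mul, ← mul_pow, sq]
  have := EisensteinSeries.r_pos z
  gcongr

lemma sq_sub_sq_ne_zero (z : ℍ) (m n : ℕ+) :
    (((m : ℕ) : ℂ) * z) ^ 2 - ((n : ℕ) : ℂ) ^ 2 ≠ 0 := by
  have := EisensteinSeries.r_pos z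
  have hn : (0 : ℝ) < ((n : ℕ) : ℝ) := Nat.cast_pos.mpr n.pos
  exact norm_pos_iff.mp (lt_of_lt_of_le (by positivity) (mul_sq_le_norm_sq_sub_sq z m n))

lemma summable_one_div_sq_mul_sq :
    Summable fun p : ℕ+ × ℕ+ => 1 / (((p.1 : ℕ) : ℂ) ^ 2 * ((p.2 : ℕ) : ℂ) ^ 2) := by
  have h := (summable_pnat_one_div_pow one_lt_two).norm
  refine (Summable.mul_norm h h).of_norm.congr fun p => ?_
  rw [one_div_mul_one_div]

lemma summable_cotDoubleTerm (z : ℍ) : Summable (cotDoubleTerm z) := by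
  have hr := EisensteinSeries.r_pos z
  refine (summable_one_div_sq_mul_sq.norm.mul_left
    (1 / EisensteinSeries.r z ^ 2)).of_norm_bounded fun p => ?_
  have hm : (0 : ℝ) < ((p.1 : ℕ) : ℝ) := Nat.cast_pos.mpr p.1.pos
  have hn : (0 : ℝ) < ((p.2 : ℕ) : ℝ) := Nat.cast_pos.mpr p.2.pos
  rw [cotDoubleTerm, norm_div, norm_div, norm_mul, norm_mul, norm_pow, norm_pow, norm_one,
    Complex.norm_natCast, Complex.norm_natCast, one_div_mul_one_div]
  refine one_div_le_one_div_of_le (by positivity) ?_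
  calc _ = ((p.1 : ℕ) : ℝ) ^ 2 * (EisensteinSeries.r z ^ 2 * ((p.2 : ℕ) : ℝ) ^ 2) := by ring
    _ ≤ _ := by gcongr; exact mul_sq_le_norm_sq_sub_sq z p.1 p.2

/-- With X = m²z² - n², the paired terms are 1/(m²X) and -z²/(n²X), whose sum is -1/(m²n²). -/
lemma tsum_cotDoubleTerm_add {z w : ℍ} (h : (z : ℂ) * w = -1) :
    ∑' p, cotDoubleTerm z p + ∑' p, cotDoubleTerm w p
      = -∑' p : ℕ+ × ℕ+, 1 / (((p.1 : ℕ) : ℂ) ^ 2 * ((p.2 : ℕ) : ℂ) ^ 2) := by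
  have hswap : Summable fun p => cotDoubleTerm w (Equiv.prodComm ℕ+ ℕ+ p) :=
    (Equiv.prodComm ℕ+ ℕ+).summable_iff.mpr (summable_cotDoubleTerm w)
  rw [← (Equiv.prodComm ℕ+ ℕ+).tsum_eq (cotDoubleTerm w), ← tsum_neg,
    ← (summable_cotDoubleTerm z).tsum_add hswap]
  refine tsum_congr fun ⟨m, n⟩ => ?_
  have hz := ne_zero z
  have hw : (w : ℂ) = -1 / z := by
    rw [eq_div_iff hz, mul_comm, h]
  have hX := sq_sub_sq_ne_zero z m n
  have hY := sq_sub_sq_ne_zero w n m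
  have hm : ((m : ℕ) : ℂ) ≠ 0 := by exact_mod_cast m.ne_zero
  have hn : ((n : ℕ) : ℂ) ≠ 0 := by exact_mod_cast n.ne_zero
  have hYX : (((n : ℕ) : ℂ) * w) ^ 2 - ((m : ℕ) : ℂ) ^ 2
      = -((((m : ℕ) : ℂ) * z) ^ 2 - ((n : ℕ) : ℂ) ^ 2) / (z : ℂ) ^ 2 := by
    rw [hw]
    field_simp
    ring
  simp only [cotDoubleTerm, Equiv.prodComm_apply, Prod.swap_prod_mk, hYX]
  set X := (((m : ℕ) : ℂ) * z) ^ 2 - ((n : ℕ) : ℂ) ^ 2 with hXdef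
  have hXeq : (((m : ℕ) : ℂ)) ^ 2 * (z : ℂ) ^ 2 = X + ((n : ℕ) : ℂ) ^ 2 := by
    rw [hXdef]; ring
  field_simp
  linear_combination -hXeq

/-- Two expansions of π cot(πmz) are equated, in powers of q and in partial fractions. The factor m³
is there to cancel the m⁻³ of the Lambert series. -/
lemma tsum_nome_pow_mul (z : ℍ) (m : ℕ+) :
    ∑' n : ℕ+, nome z ^ (m * n : ℕ) = -1 / 2 - 1 / (2 * Real.pi * I) *
      (1 / ((m : ℕ) * z) + 2 * z * ∑' n : ℕ+,
        ((m : ℕ) : ℂ) ^ 3 * cotDoubleTerm z (m, n)) := by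
  have h1 := pi_mul_cot_pi_q_exp (scaleTau m z)
  have h2 := cot_series_rep (coe_mem_integerComplement (scaleTau m z))
  have hm : ((m : ℕ) : ℂ) ≠ 0 := by exact_mod_cast m.ne_zero
  have hsum : Summable fun n : ℕ => nome (scaleTau m z) ^ n :=
    summable_geometric_of_norm_lt_one (norm_nome_lt_one _)
  have h3 := tsum_zero_pnat_eq_tsum_nat hsum
  have hc : ((scaleTau m z : ℍ) : ℂ) = (m : ℕ) * z := rfl
  have h4 : ∑' n : ℕ+, (1 / (((m : ℕ) : ℂ) * z - (n : ℕ)) + 1 / (((m : ℕ) : ℂ) * z + (n : ℕ)))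
      = 2 * z * ∑' n : ℕ+, ((m : ℕ) : ℂ) ^ 3 * cotDoubleTerm z (m, n) := by
    rw [← tsum_mul_left]
    refine tsum_congr fun n => ?_
    have hX := sq_sub_sq_ne_zero z m n
    rw [cotDoubleTerm]
    simp only
    rw [sq_sub_sq] at hX ⊢
    have := left_ne_zero_of_mul hX
    have := right_ne_zero_of_mul hX
    field_simp
    ring
  rw [hc, h4] at h2
  rw [hc, h2, ← hc] at h1
  change _ = Real.pi * I - 2 * Real.pi * I * ∑' n : ℕ, nome (scaleTau m z) ^ n at h1
  rw [← h3, hc] at h1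
  rw [h1]
  simp only [nome_scaleTau, ← pow_mul, pow_zero]
  have hpi : (Real.pi : ℂ) ≠ 0 := by exact_mod_cast Real.pi_ne_zero
  have hI := I_ne_zero
  field_simp
  ring

lemma eichlerSigma_eq (z : ℍ) :
    eichlerSigma z = -1 / 2 * riemannZeta 3 - 1 / (2 * Real.pi * I) *
      (riemannZeta 4 / z + 2 * z * ∑' p, cotDoubleTerm z p) := by
  have hD := summable_cotDoubleTerm z
  have h3 := summable_pnat_one_div_pow (k := 3) (by norm_num)
  have h4 := summable_pnat_one_div_pow (k := 4) (by norm_num)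
  have z3 := tsum_pnat_one_div_pow (k := 3) (by norm_num)
  have z4 := tsum_pnat_one_div_pow (k := 4) (by norm_num)
  push_cast at z3 z4
  rw [eichlerSigma_eq_tsum_prod, (summable_lambert z).tsum_prod, hD.tsum_prod, ← z3, ← z4]
  have hz := ne_zero z
  have key : HasSum (fun m : ℕ+ => -1 / 2 * (1 / ((m : ℕ) : ℂ) ^ 3) - 1 / (2 * Real.pi * I) *
      (1 / ((m : ℕ) : ℂ) ^ 4 / z + 2 * z * ∑' n, cotDoubleTerm z (m, n))) _ :=
    (h3.hasSum.mul_left _).sub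
      (((h4.hasSum.div_const _).add (hD.prod.hasSum.mul_left _)).mul_left _)
  rw [← key.tsum_eq]
  refine tsum_congr fun m => ?_
  have hm : ((m : ℕ) : ℂ) ≠ 0 := by exact_mod_cast m.ne_zero
  simp only
  rw [tsum_mul_left, tsum_nome_pow_mul, tsum_mul_left]
  have hpi : (Real.pi : ℂ) ≠ 0 := by exact_mod_cast Real.pi_ne_zero
  have hI := I_ne_zero
  field_simp

/-- A and B may stay anonymous, since their terms cancel in the final combination. -/
lemma exists_eichlerSigma_inversion : ∃ A B : ℂ, ∀ z w : ℍ, (z : ℂ) * w = -1 →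
    (z : ℂ) ^ 2 * eichlerSigma w = eichlerSigma z - 1 / 2 * riemannZeta 3 * ((z : ℂ) ^ 2 - 1)
      + A * (1 / z + (z : ℂ) ^ 3) + B * z := by
  refine ⟨1 / (2 * Real.pi * I) * riemannZeta 4, -(1 / (2 * Real.pi * I)) * (2 *
    ∑' p : ℕ+ × ℕ+, 1 / (((p.1 : ℕ) : ℂ) ^ 2 * ((p.2 : ℕ) : ℂ) ^ 2)), fun z w h => ?_⟩
  have hD := tsum_cotDoubleTerm_add h
  have hz := ne_zero z
  have hw : (w : ℂ) = -1 / z := by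
    rw [eq_div_iff hz, mul_comm, h]
  rw [eichlerSigma_eq w, eichlerSigma_eq z, eq_sub_of_add_eq' hD, hw]
  generalize 1 / (2 * Real.pi * I) = c
  field_simp
  ring

/-! ### The Fricke involution and the period polynomial -/

lemma coe_frickeW8_smul (τ : ℍ) : ((frickeW8 • τ : ℍ) : ℂ) = -1 / (8 * τ) := by
  have h := coe_smul_of_det_pos (g := (frickeW8 : GL (Fin 2) ℝ)) frickeW8.2 τ
  refine Eq.trans h ?_
  simp [frickeW8, num, denom, Matrix.GeneralLinearGroup.mkOfDetNeZero]

lemma slashOp_frickeW8 (f : ℍ → ℂ) (τ : ℍ) :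
    slashOp (-2) frickeW8 f τ = 8 * (τ : ℂ) ^ 2 * f (frickeW8 • τ) := by
  have hdet : ((frickeW8 : GL (Fin 2) ℝ).det : ℝ) = 8 := by
    simp [frickeW8, Matrix.GeneralLinearGroup.mkOfDetNeZero, Matrix.det_fin_two]
  have hden : denom (frickeW8 : GL (Fin 2) ℝ) τ = 8 * τ := by
    simp [frickeW8, denom, Matrix.GeneralLinearGroup.mkOfDetNeZero]
  have hpow : (8 : ℝ) ^ (((-2 : ℤ) : ℝ) / 2) = 8⁻¹ := by
    rw [show ((-2 : ℤ) : ℝ) / 2 = -1 by norm_num, Real.rpow_neg_one]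
  rw [slashOp, hdet, hden, hpow, neg_neg, zpow_ofNat]
  push_cast
  ring

lemma eichlerIntegral_g8 (τ : ℍ) :
    eichlerIntegral g8 τ = eichlerSigma τ - 21 / 8 * eichlerSigma (scaleTau 2 τ)
      + 21 / 16 * eichlerSigma (scaleTau 4 τ) - 1 / 8 * eichlerSigma (scaleTau 8 τ) :=
  (hasSum_eichlerIntegral_g8 τ).tsum_eq

lemma periodP8_eq (τ : ℍ) :
    periodP8 τ = 7 / 32 * riemannZeta 3 * (8 * (τ : ℂ) ^ 2 + 1) := by
  obtain ⟨A, B, h⟩ := exists_eichlerSigma_inversion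
  have hτ := ne_zero τ
  have h1 := h (scaleTau 8 τ) (scaleTau 1 (frickeW8 • τ))
    (by simp only [scaleTau, coe_frickeW8_smul]; push_cast; field_simp)
  have h2 := h (scaleTau 4 τ) (scaleTau 2 (frickeW8 • τ))
    (by simp only [scaleTau, coe_frickeW8_smul]; push_cast; field_simp; norm_num)
  have h4 := h (scaleTau 2 τ) (scaleTau 4 (frickeW8 • τ))
    (by simp only [scaleTau, coe_frickeW8_smul]; push_cast; field_simp; norm_num)
  have h8 := h (scaleTau 1 τ) (scaleTau 8 (frickeW8 • τ))
    (by simp only [scaleTau, coe_frickeW8_smul]; push_cast; field_simp)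
  have hc (e : ℕ+) : ((scaleTau e τ : ℍ) : ℂ) = (e : ℕ) * τ := rfl
  rw [hc] at h1 h2 h4 h8
  rw [scaleTau_one] at h1 h8
  rw [periodP8, slashOp_frickeW8, eichlerIntegral_g8, eichlerIntegral_g8]
  push_cast at h1 h2 h4 h8
  rw [mul_pow] at h1 h2 h4 h8
  -- For z = (8/e)τ one has 8τ² = (e²/8)z², so each coefficient is e²/8 times that of φ(eτ) in
  -- `eichlerIntegral_g8`.
  linear_combination (1 / 8) * h1 - (21 / 16) * h2 + (21 / 8) * h4 - h8

end

theorem mainTheorem3 :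
    (∀ τ : ℍ, HasSum (fun n : ℕ+ => fourierCoefficient g8 n * nome τ ^ (n : ℕ)) (g8 τ)) ∧
    (∀ τ : ℍ, Summable
      (fun n : ℕ+ => fourierCoefficient g8 n / ((n : ℕ) : ℂ) ^ 3 * nome τ ^ (n : ℕ))) ∧
    (∃ P : Polynomial ℂ, P.natDegree ≤ 2 ∧ ∀ τ : ℍ, periodP8 τ = P.eval (τ : ℂ)) ∧
    (∀ τ : ℍ, periodP8 τ = 7 / 32 * riemannZeta 3 * (8 * (τ : ℂ) ^ 2 + 1)) := by
  refine ⟨fun τ => ?_, fun τ => (hasSum_eichlerIntegral_g8 τ).summable, ?_, periodP8_eq⟩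
  · simp only [fourierCoefficient_g8]
    exact hasSum_pnat_of_hasSum_nat (f := fun n => g8Coeff n * nome τ ^ n)
      (by simp [g8Coeff_zero]) (hasSum_g8 τ)
  · refine ⟨.C (7 / 32 * riemannZeta 3) * (.C 8 * .X ^ 2 + .C 1), ?_, fun τ => ?_⟩
    · compute_degree
    · simp [periodP8_eq]
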